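/- Let $F=\mathbf Z/2$ and let $V$ be an $F$-vector space with a symplectic (i.e. alternating bilinear, possibly degenerate) form $\langle\,,\rangle$ and a basis $(e_s)_{s\in S}$ indexed by a finite set $S$, such that the graph with vertex set $S$, in which distinct $s,s'$ are joined iff $\langle e_s,e_{s'}\rangle=1$, is a cycle with $N=|S|$ vertices, where $N\ge3$ is odd. Put $e_I=\sum_{s\in I}e_s$ for $I\subset S$, let $\bar V=V/Fe_S$ with the induced symplectic form, let $\bar e_s$ be the image of $e_s$ in $\bar V$ and put $\bar e_I=\sum_{s\in I}\bar e_s$. The graph on $S$ defined by the $\bar e_s$ and the induced form is the same cycle. Let $\mathcal I^1$ be the set of $I\subset S$ of odd cardinality whose full subgraph $\underline I$ is a path (type $A_m$, $m\ge1$). For $I,I'\in\mathcal I^1$ write $I\prec I'$ if $I\subsetneq I'$ and $\underline{I'-I}$ is disconnected, and $I\spadesuit I'$ if $I\cap I'=\emptyset$ and $\underline{I\cup I'}$ is disconnected. Let $I^{ev}$ be the set of all $s\in I$ such that $I-\{s\}=I'\sqcup I''$ with $I',I''\in\mathcal I^1$, $I'\spadesuit I''$. Let $\phi(\bar V)$ be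 the set of all finite sets $B\subset\mathcal I^1$ such that $(P_0)$ any $I,I'\in B$ satisfy $I=I'$ or $I\spadesuit I'$ or $I\prec I'$ or $I'\prec I$; $(P_1)$ for any $I\in B$ there are pairwise disjoint $I_1,\dots,I_k\in B$ ($k\ge0$) with $I_j\prec I$ for all $j$ and $I^{ev}\subset I_1\cup\dots\cup I_k$. For $B\in\phi(\bar V)$ and $s\in S$ let $g_s(B)=|\{I\in B: s\in I\}|$ and $\bar\varepsilon(B)=\sum_{s\in S}\tfrac12 g_s(B)(g_s(B)+1)\,\bar e_s\in\bar V$. Fix an edge $\mathbf e$ of the graph, regarded as a two-element subset of $S$. Let $z_{\mathbf e}:\bar V\to F$ be the linear function with $z_{\mathbf e}(\bar e_s)=1$ if $s\in\mathbf e$ and $z_{\mathbf e}(\bar e_s)=0$ if $s\in S-\mathbf e$. For a finite set $B\subset\mathcal I^1$ let $n_B=|\{I\in B:\mathbf e\subset I\}|$. If $B\in\phi(\bar V)$ has a member meeting $\mathbf e$ (in particular if $n_B>0$), then there is a unique $I_B\in B$ with $|I_B\cap\mathbf e|=1$. For $B\in\phi(\bar V)$ put $B^!=B-\{I_B\}$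 if $n_B$ is odd and $B^!=B$ if $n_B$ is even. The map $B\mapsto B^!$ is injective on $\phi(\bar V)$. Let $\omega(\bar V)=\{B^!:B\in\phi(\bar V)\}$; for $B\in\omega(\bar V)$ let $\tilde B$ be the element of $\phi(\bar V)$ with $\tilde B^!=B$, put $'\varepsilon(B)=\bar\varepsilon(\tilde B)$, and let $\langle B\rangle$ be the subspace of $\bar V$ spanned by $\{\bar e_I: I\in B\}$. Let $\omega^+(\bar V)=\{B\in\omega(\bar V): z_{\mathbf e}('\varepsilon(B))=0\}$. For $B',B\in\omega(\bar V)$ write $B'\preceq B$ if there is a sequence $B'=B_0,B_1,\dots,B_k=B$ in $\omega(\bar V)$ ($k\ge0$) with $'\varepsilon(B_i)\in\langle B_{i+1}\rangle$ for $0\le i<k$. Then: (1) For $B\in\omega(\bar V)$ we have $B\in\omega^+(\bar V)$ if and only if $|I\cap\mathbf e|\in\{0,2\}$ for all $I\in B$. (2) If $B',B\in\omega(\bar V)$ satisfy $B'\preceq B$ and $B\in\omega^+(\bar V)$, then $B'\in\omega^+(\bar V)$. -/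

import Mathlib

namespace IsotropicFamily

/-! ### Graphs, intervals and the family `phi` -/

section Graph

variable {S : Type*}

/-- The graph `(S, E)` attached to a bilinear form and a family of vectors `e`:
distinct `s, t` are joined iff `⟨e s, e t⟩ = 1` (for a symplectic form over `ZMod 2`
this relation is symmetric). -/
def edgeGraph {W : Type*} [AddCommGroup W] [Module (ZMod 2) W]
    (form : LinearMap.BilinForm (ZMod 2) W) (e : S → W) : SimpleGraph S :=
  SimpleGraph.fromRel fun s t => form (e s) (e t) = 1

/-- The full subgraph with vertex set `X` is disconnected. -/
def IsDisconnected (G : SimpleGraph S) (X : Finset S) : Prop :=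
  ¬ (G.induce (X : Set S)).Preconnected

/-- The set of all `I ⊆ S` whose full subgraph is of type `A_m` (a path with `m` vertices)
for some `m ≥ 1`. -/
def paths (G : SimpleGraph S) : Set (Finset S) :=
  {I | ∃ m : ℕ, 1 ≤ m ∧ Nonempty (G.induce (I : Set S) ≃g SimpleGraph.pathGraph m)}

/-- The members of `paths G` of odd cardinality. -/
def oddPaths (G : SimpleGraph S) : Set (Finset S) :=
  {I | I ∈ paths G ∧ Odd I.card}

/-- `R`: the finite sets of odd paths. -/
def families (G : SimpleGraph S) : Set (Finset (Finset S)) :=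
  {B | ∀ I ∈ B, I ∈ oddPaths G}

variable [DecidableEq S]

/-- `I ≺ I'`: proper inclusion with `I' - I` disconnected. -/
def Nested (G : SimpleGraph S) (I I' : Finset S) : Prop :=
  I ⊂ I' ∧ IsDisconnected G (I' \ I)

/-- `I ♠ I'`: disjoint with `I ∪ I'` disconnected. -/
def Separated (G : SimpleGraph S) (I I' : Finset S) : Prop :=
  Disjoint I I' ∧ IsDisconnected G (I ∪ I')

/-- `I^ev`: the `s ∈ I` such that `I - {s}` is the union of two separated odd paths. -/
def evPart (G : SimpleGraph S) (I : Finset S) : Set S :=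
  {s | s ∈ I ∧ ∃ I' ∈ oddPaths G, ∃ I'' ∈ oddPaths G,
    Separated G I' I'' ∧ I.erase s = I' ∪ I''}

/-- Property `(P₀)`. -/
def PropP0 (G : SimpleGraph S) (B : Finset (Finset S)) : Prop :=
  ∀ I ∈ B, ∀ I' ∈ B, I = I' ∨ Separated G I I' ∨ Nested G I I' ∨ Nested G I' I

/-- Property `(P₁)`: for every `I ∈ B` the set `I^ev` is covered by pairwise disjoint members
of `B`, each of them `≺ I`. -/
def PropP1 (G : SimpleGraph S) (B : Finset (Finset S)) : Prop :=
  ∀ I ∈ B, ∃ C ⊆ B, (C : Set (Finset S)).PairwiseDisjoint id ∧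
    (∀ J ∈ C, Nested G J I) ∧ evPart G I ⊆ (C.biUnion id : Finset S)

/-- The set `phi` of families of odd paths satisfying `(P₀)` and `(P₁)`. -/
def phi (G : SimpleGraph S) : Set (Finset (Finset S)) :=
  {B | B ∈ families G ∧ PropP0 G B ∧ PropP1 G B}

/-- `g_s(B)`: the number of members of `B` containing `s`. -/
def mult (B : Finset (Finset S)) (s : S) : ℕ :=
  (B.filter fun I => s ∈ I).card

/-- `ε(B) = ∑ s, (g_s(B) (g_s(B) + 1) / 2) e_s`; the natural-number division is exact. -/
def eps [Fintype S] {W : Type*} [AddCommGroup W] [Module (ZMod 2) W]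
    (e : S → W) (B : Finset (Finset S)) : W :=
  ∑ s, ((mult B s * (mult B s + 1) / 2 : ℕ) : ZMod 2) • e s

/-- `n_B`: the number of members of `B` containing `ee`. -/
def edgeMult (ee : Finset S) (B : Finset (Finset S)) : ℕ :=
  (B.filter fun I => ee ⊆ I).card

/-- `I_B`: the member `I` of `B` with `|I ∩ ee| = 1`, if there is one. -/
noncomputable def special (ee : Finset S) (B : Finset (Finset S)) : Finset S :=
  Classical.epsilon fun I => I ∈ B ∧ (I ∩ ee).card = 1

/-- `B^!`: remove `I_B` from `B` if `n_B` is odd, keep `B` if `n_B` is even. -/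
noncomputable def bang (ee : Finset S) (B : Finset (Finset S)) : Finset (Finset S) :=
  if Odd (edgeMult ee B) then B.erase (special ee B) else B

/-- `ω = {B^! ; B ∈ phi}`. -/
def omega (G : SimpleGraph S) (ee : Finset S) : Set (Finset (Finset S)) :=
  bang ee '' phi G

/-- For `B ∈ ω`, the element `B~` of `phi` with `(B~)^! = B`. -/
noncomputable def tilde (G : SimpleGraph S) (ee : Finset S) (B : Finset (Finset S)) :
    Finset (Finset S) :=
  Function.invFunOn (bang ee) (phi G) B

end Graph

/-! ### The circular symplectic space -/

/-- A space `V` over `ZMod 2` with a symplectic form and a basis `e` indexed by `S` such that the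
associated graph on `S` is of affine type `A_{N-1}` (a cycle with `N` vertices), with `N = |S|`
odd and at least `3`. -/
structure AffineData (S V : Type*) [Fintype S] [AddCommGroup V] [Module (ZMod 2) V] where
  form : LinearMap.BilinForm (ZMod 2) V
  isAlt : form.IsAlt
  e : Module.Basis S (ZMod 2) V
  odd_card : Odd (Fintype.card S)
  three_le : 3 ≤ Fintype.card S
  cycle : Nonempty (edgeGraph form e ≃g SimpleGraph.cycleGraph (Fintype.card S))

namespace AffineData

variable {S V : Type*} [Fintype S] [AddCommGroup V] [Module (ZMod 2) V]
  (D : AffineData S V)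

/-- The line spanned by `e_S = ∑ s, e_s`. -/
def line : Submodule (ZMod 2) V := Submodule.span (ZMod 2) {∑ s, D.e s}

/-- `V̄ = V / F e_S`. -/
abbrev Vbar : Type _ := V ⧸ D.line

/-- The vectors `ē_s`, the images of the `e_s` in `V̄`. -/
noncomputable def ebar (s : S) : D.Vbar := D.line.mkQ (D.e s)

theorem line_le_ker {W : Type*} [AddCommGroup W] [Module (ZMod 2) W] (f : V →ₗ[ZMod 2] W)
    (h : f (∑ s, D.e s) = 0) : D.line ≤ LinearMap.ker f :=
  (Submodule.span_singleton_le_iff_mem _ _).2 (LinearMap.mem_ker.2 h)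

theorem form_symm (x y : V) : D.form x y = D.form y x := by
  rw [← D.isAlt.neg_eq, ZMod.neg_eq_self_mod_two]

theorem form_sum_left (x : V) : D.form (∑ s, D.e s) x = 0 := by
  classical
  suffices h : D.form (∑ s, D.e s) = 0 by rw [h]; rfl
  refine D.e.ext fun t => ?_
  have hval : ∀ s, D.form (D.e s) (D.e t) =
      if (edgeGraph D.form D.e).Adj t s then 1 else 0 := by
    intro s
    have hadj : (edgeGraph D.form D.e).Adj t s ↔ D.form (D.e s) (D.e t) = 1 := by
      simp only [edgeGraph, SimpleGraph.fromRel_adj, D.form_symm (D.e t) (D.e s), or_self]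
      refine ⟨fun h => h.2, fun h => ⟨?_, h⟩⟩
      rintro rfl
      rw [D.isAlt.self_eq_zero] at h
      exact zero_ne_one h
    have h2 : ∀ a : ZMod 2, a = if a = 1 then 1 else 0 := by decide
    simp only [hadj]
    exact h2 _
  have hdeg : (edgeGraph D.form D.e).degree t = 2 := by
    obtain ⟨f⟩ := D.cycle
    rw [← f.degree_eq t]
    generalize f t = u
    have h3 := D.three_le
    revert u
    obtain ⟨k, hk⟩ := Nat.exists_eq_add_of_le h3
    rw [hk, Nat.add_comm 3 k]
    intro u
    convert SimpleGraph.cycleGraph_degree_three_le (v := u)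
  rw [map_sum, LinearMap.sum_apply, LinearMap.zero_apply, Finset.sum_congr rfl fun s _ => hval s,
    Finset.sum_boole]
  have : (Finset.univ.filter fun s => (edgeGraph D.form D.e).Adj t s).card = 2 := by
    refine Eq.trans ?_ hdeg
    rw [← SimpleGraph.card_neighborFinset_eq_degree]
    congr 1
    ext s
    simp
  exact (congrArg (Nat.cast : ℕ → ZMod 2) this).trans (by decide)

/-- The form on `V̄` induced by the form on `V`. -/
noncomputable def formBar : LinearMap.BilinForm (ZMod 2) D.Vbar :=
  D.line.liftQ
    { toFun := fun x => D.line.liftQ (D.form x)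
        (D.line_le_ker _ (by rw [D.form_symm, D.form_sum_left]))
      map_add' := fun x y => by
        apply Submodule.linearMap_qext
        ext z
        simp
      map_smul' := fun c x => by
        apply Submodule.linearMap_qext
        ext z
        simp }
    (D.line_le_ker _ (by
      apply Submodule.linearMap_qext
      ext z
      simpa using D.form_sum_left z))

theorem formBar_mk (x y : V) :
    D.formBar (D.line.mkQ x) (D.line.mkQ y) = D.form x y := rfl

/-- The graph `(S, E)` attached to `V̄`, its induced form and the vectors `ē_s`. -/
noncomputable def graph : SimpleGraph S := edgeGraph D.formBar D.ebar

variable [DecidableEq S]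

/-- `ee` is (the set of end points of) an edge of the graph. -/
def IsEdge (ee : Finset S) : Prop := ∃ s t, D.graph.Adj s t ∧ ee = {s, t}

/-- The linear function `z : V̄ → F` with `z(ē_s) = 1` for `s ∈ ee` and `z(ē_s) = 0` for
`s ∉ ee`. -/
noncomputable def z (ee : Finset S) (hee : D.IsEdge ee) : D.Vbar →ₗ[ZMod 2] ZMod 2 :=
  D.line.liftQ (D.e.constr (ZMod 2) fun s => if s ∈ ee then (1 : ZMod 2) else 0) (D.line_le_ker _ (by
    obtain ⟨s, t, hst, rfl⟩ := hee
    rw [map_sum]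
    simp only [Module.Basis.constr_basis, Finset.sum_boole]
    have : (Finset.univ.filter fun u => u ∈ ({s, t} : Finset S)) = {s, t} := by ext; simp
    rw [this, Finset.card_pair hst.ne]
    decide))

theorem z_ebar (ee : Finset S) (hee : D.IsEdge ee) (s : S) :
    D.z ee hee (D.ebar s) = if s ∈ ee then 1 else 0 := by
  simp [z, ebar]

/-- `ω(V̄)`. -/
def omegaBar (ee : Finset S) : Set (Finset (Finset S)) := omega D.graph ee

/-- `'ε(B) = ε̄(B~)` for `B ∈ ω(V̄)`. -/
noncomputable def epsPrime (ee : Finset S) (B : Finset (Finset S)) : D.Vbar :=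
  eps D.ebar (tilde D.graph ee B)

/-- `ω⁺(V̄)`: the `B ∈ ω(V̄)` with `z('ε(B)) = 0`. -/
def omegaPlus (ee : Finset S) (hee : D.IsEdge ee) : Set (Finset (Finset S)) :=
  {B | B ∈ D.omegaBar ee ∧ D.z ee hee (D.epsPrime ee B) = 0}

/-- `<B>`: the subspace of `V̄` spanned by the `ē_I = ∑ s ∈ I, ē_s` with `I ∈ B`. -/
def spanOf (B : Finset (Finset S)) : Submodule (ZMod 2) D.Vbar :=
  Submodule.span (ZMod 2) ((fun I : Finset S => ∑ s ∈ I, D.ebar s) '' (B : Set (Finset S)))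

/-- `B' ⪯ B` on `ω(V̄)`: there are `B' = B₀, B₁, …, B_k = B` in `ω(V̄)` with
`'ε(B_i) ∈ <B_{i+1}>` for all `i < k`. -/
def Preceq (ee : Finset S) (B' B : D.omegaBar ee) : Prop :=
  Relation.ReflTransGen
    (fun X Y : D.omegaBar ee => D.epsPrime ee X.1 ∈ D.spanOf Y.1) B' B

end AffineData

end IsotropicFamily

/-! Let s, t be the ends of the edge and let B in `phi` have a member meeting it. A smallest such
member cannot contain both ends, since one of two adjacent vertices of an odd path lies in its
`evPart`, which (P₁) covers by smaller members. So some member contains exactly one end, and (P₀)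
with degree 2 makes it unique (`existsUnique_special`). All other members contain both ends or
neither, so the multiplicities at s, t are n and n + 1 in some order, where n = `edgeMult`. Two
consecutive triangular numbers add up to n + 1 mod 2, hence z(ε(B)) = n + 1. This vanishes iff n is
odd, which is exactly when `bang` deletes the exceptional member. That gives (1); if no member meets
the edge, both sides hold trivially. For (2), z kills ē_I whenever I meets the edge in 0 or 2
points, hence kills all of ⟨B⟩; this propagates down a chain for ⪯. -/

namespace IsotropicFamily

/-! ### Ordered paths, their even vertices and connected subsets -/

section PathOrder

variable {S : Type*}

/-- `p` lists the vertices of the path `I` in order. -/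
structure IsPathOrder (G : SimpleGraph S) (p : ℕ → S) (m : ℕ) (I : Finset S) : Prop where
  mem : ∀ i < m, p i ∈ I
  surj : ∀ s ∈ I, ∃ i < m, p i = s
  inj : ∀ i < m, ∀ j < m, p i = p j → i = j
  adj : ∀ i < m, ∀ j < m, (G.Adj (p i) (p j) ↔ i + 1 = j ∨ j + 1 = i)

theorem exists_isPathOrder {G : SimpleGraph S} {I : Finset S} (hI : I ∈ paths G) :
    ∃ p m, IsPathOrder G p m I := by
  obtain ⟨m, hm, ⟨f⟩⟩ := hI
  -- Positions i ≥ m get the first vertex as a junk value.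
  have hp : ∀ i (h : i < m), (if h : i < m then (f.symm ⟨i, h⟩ : S) else f.symm ⟨0, hm⟩) =
      f.symm ⟨i, h⟩ := fun i h => dif_pos h
  refine ⟨fun i => if h : i < m then f.symm ⟨i, h⟩ else f.symm ⟨0, hm⟩, m, ?_, ?_, ?_, ?_⟩
  · intro i h
    simp only [hp i h]
    exact (f.symm ⟨i, h⟩).2
  · intro s hs
    refine ⟨f ⟨s, hs⟩, (f ⟨s, hs⟩).2, ?_⟩
    simp only [hp _ (f ⟨s, hs⟩).2, Fin.eta]
    rw [f.symm_apply_apply]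
  · intro i hi j hj hij
    simp only [hp i hi, hp j hj] at hij
    simpa using f.symm.injective (Subtype.ext hij)
  · intro i hi j hj
    simp only [hp i hi, hp j hj]
    have := f.symm.map_adj_iff (v := ⟨i, hi⟩) (w := ⟨j, hj⟩)
    rw [SimpleGraph.pathGraph_adj] at this
    exact this

namespace IsPathOrder

variable {G : SimpleGraph S} {p : ℕ → S} {m : ℕ} {I : Finset S}

theorem mem_paths (h : IsPathOrder G p m I) (hm : 1 ≤ m) : I ∈ paths G := by
  let f : Fin m → (I : Set S) := fun i => ⟨p i, h.mem i i.2⟩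
  have hf : f.Bijective := by
    constructor
    · intro i j hij
      exact Fin.ext (h.inj i i.2 j j.2 (congrArg Subtype.val hij))
    · rintro ⟨s, hs⟩
      obtain ⟨i, hi, rfl⟩ := h.surj s hs
      exact ⟨⟨i, hi⟩, rfl⟩
  refine ⟨m, hm, ⟨SimpleGraph.Iso.symm ⟨Equiv.ofBijective f hf, ?_⟩⟩⟩
  intro i j
  rw [SimpleGraph.pathGraph_adj]
  exact h.adj i i.2 j j.2

theorem card_eq (h : IsPathOrder G p m I) : I.card = m := by
  classical
  have : I = (Finset.range m).image p := by
    ext s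
    simp only [Finset.mem_image, Finset.mem_range]
    constructor
    · exact h.surj s
    · rintro ⟨i, hi, rfl⟩
      exact h.mem i hi
  rw [this, Finset.card_image_of_injOn, Finset.card_range]
  intro i hi j hj hij
  exact h.inj i (by simpa using hi) j (by simpa using hj) hij

theorem reverse (h : IsPathOrder G p m I) : IsPathOrder G (fun i => p (m - 1 - i)) m I where
  mem i hi := h.mem _ (by omega)
  surj s hs := by
    obtain ⟨i, hi, rfl⟩ := h.surj s hs
    exact ⟨m - 1 - i, by omega, congrArg p (by omega)⟩
  inj i hi j hj hij := by
    have := h.inj _ (by omega) _ (by omega) hij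
    omega
  adj i hi j hj := by
    rw [h.adj _ (by omega) _ (by omega)]
    omega

theorem segment [DecidableEq S] (h : IsPathOrder G p m I) {a k : ℕ} (hk : a + k ≤ m) :
    IsPathOrder G (fun i => p (a + i)) k ((Finset.range k).image fun i => p (a + i)) where
  mem i hi := Finset.mem_image_of_mem (fun i => p (a + i)) (Finset.mem_range.2 hi)
  surj s hs := by simpa using hs
  inj i hi j hj hij := by
    have := h.inj _ (by omega) _ (by omega) hij
    omega
  adj i hi j hj := by
    rw [h.adj _ (by omega) _ (by omega)]
    omega

end IsPathOrder

theorem preconnected_of_mem_paths {G : SimpleGraph S} {I : Finset S} (hI : I ∈ paths G) :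
    (G.induce (I : Set S)).Preconnected := by
  obtain ⟨m, -, ⟨f⟩⟩ := hI
  exact f.preconnected_iff.2 (SimpleGraph.pathGraph_preconnected m)

/-- Connectedness as an invariance principle: a property preserved along edges inside X spreads from
one vertex to all of X. -/
theorem closed_of_preconnected {G : SimpleGraph S} {X : Set S}
    (hX : (G.induce X).Preconnected) {P : S → Prop}
    (hP : ∀ x ∈ X, ∀ y ∈ X, G.Adj x y → P x → P y) {x y : S} (hx : x ∈ X) (hy : y ∈ X)
    (h : P x) : P y := by
  obtain ⟨w⟩ := hX ⟨x, hx⟩ ⟨y, hy⟩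
  suffices ∀ u v : X, (G.induce X).Walk u v → P u → P v from this _ _ w h
  intro u v w
  induction w with
  | nil => exact id
  | cons hadj _ ih => exact fun hu => ih (hP _ (Subtype.coe_prop _) _ (Subtype.coe_prop _) hadj hu)

namespace IsPathOrder

variable [DecidableEq S] {G : SimpleGraph S} {p : ℕ → S} {m : ℕ} {I : Finset S}

/-- Positions start at 0, so deleting position i leaves pieces of lengths i and m - i - 1, both odd
when m and i are. -/
theorem mem_evPart (h : IsPathOrder G p m I) (hm : Odd m) {i : ℕ} (hi : i < m) (hodd : Odd i) :
    p i ∈ evPart G I := by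
  obtain ⟨c, hc⟩ := hm
  obtain ⟨d, hd⟩ := hodd
  have h1 := h.segment (a := 0) (k := i) (by omega)
  have h2 := h.segment (a := i + 1) (k := m - i - 1) (by omega)
  refine ⟨h.mem i hi, _, ⟨h1.mem_paths (by omega), ?_⟩, _, ⟨h2.mem_paths (by omega), ?_⟩,
    ⟨?_, ?_⟩, ?_⟩
  · rw [h1.card_eq]
    exact ⟨d, hd⟩
  · rw [h2.card_eq]
    exact ⟨c - d - 1, by omega⟩
  · rw [Finset.disjoint_left]
    simp only [Finset.mem_image, Finset.mem_range, not_exists, not_and]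
    rintro _ ⟨a, ha, rfl⟩ b hb hab
    have := h.inj _ (by omega) _ (by omega) hab
    omega
  · intro hcon
    -- With position i deleted, the positions below i are closed under adjacency, so the second
    -- piece cannot be reached.
    have key : ∃ a < i, p a = p (i + 1) := by
      refine closed_of_preconnected hcon (P := fun s => ∃ a < i, p a = s) (x := p 0) ?_ ?_ ?_
        ⟨0, by omega, rfl⟩
      · rintro _ - y hy hadj ⟨a, ha, rfl⟩
        simp only [Finset.coe_union, Finset.coe_image, Finset.coe_range, Set.mem_union,
          Set.mem_image, Set.mem_Iio] at hy
        rcases hy with ⟨b, hb, rfl⟩ | ⟨b, hb, rfl⟩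
        · exact ⟨0 + b, by omega, rfl⟩
        · rw [h.adj _ (by omega) _ (by omega)] at hadj
          omega
      · exact Finset.mem_coe.2 (Finset.mem_union_left _ (h1.mem 0 (by omega)))
      · exact Finset.mem_coe.2 (Finset.mem_union_right _ (h2.mem 0 (by omega)))
    obtain ⟨a, ha, hab⟩ := key
    have := h.inj _ (by omega) _ (by omega) hab
    omega
  · ext s
    simp only [Finset.mem_erase, Finset.mem_union, Finset.mem_image, Finset.mem_range]
    constructor
    · rintro ⟨hne, hs⟩
      obtain ⟨j, hj, rfl⟩ := h.surj s hs
      have : j ≠ i := fun e => hne (e ▸ rfl)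
      rcases lt_or_gt_of_ne this with hlt | hgt
      · exact Or.inl ⟨j, hlt, congrArg p (by omega)⟩
      · exact Or.inr ⟨j - i - 1, by omega, congrArg p (by omega)⟩
    · rintro (⟨j, hj, rfl⟩ | ⟨j, hj, rfl⟩)
      · refine ⟨fun e => ?_, h.mem _ (by omega)⟩
        have := h.inj _ (by omega) _ (by omega) e
        omega
      · refine ⟨fun e => ?_, h.mem _ (by omega)⟩
        have := h.inj _ (by omega) _ (by omega) e
        omega

/-- A connected part of a path containing its initial vertex has connected complement. -/
theorem not_nested (h : IsPathOrder G p m I) {J : Finset S}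
    (hJ : (G.induce (J : Set S)).Preconnected) (h0 : p 0 ∈ J) : ¬ Nested G J I := by
  rintro ⟨hJI, hdis⟩
  -- J is an initial segment: if it skipped position i, connectedness would confine it to positions
  -- below i.
  have down : ∀ j < m, p j ∈ J → ∀ i ≤ j, p i ∈ J := by
    intro j hj hjJ i hij
    by_contra hiJ
    have key : ∃ a < i, p a = p j := by
      refine closed_of_preconnected hJ (P := fun s => ∃ a < i, p a = s) ?_ h0 hjJ
        ⟨0, Nat.pos_of_ne_zero fun e => hiJ (e ▸ h0), rfl⟩
      rintro _ - y hy hadj ⟨a, ha, rfl⟩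
      obtain ⟨b, hb, rfl⟩ := h.surj y (hJI.1 hy)
      rw [h.adj _ (by omega) _ hb] at hadj
      have : b ≠ i := fun e => hiJ (e ▸ hy)
      exact ⟨b, by omega, rfl⟩
    obtain ⟨a, ha, hab⟩ := key
    have := h.inj _ (by omega) _ hj hab
    omega
  classical
  have hex : ∃ i, i < m ∧ p i ∉ J := by
    obtain ⟨s, hs, hsJ⟩ := Finset.exists_of_ssubset hJI
    obtain ⟨i, hi, rfl⟩ := h.surj s hs
    exact ⟨i, hi, hsJ⟩
  obtain ⟨hkm, hkJ⟩ := Nat.find_spec hex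
  set k := Nat.find hex
  -- With k the first position outside J, the complement is the final segment from k on, again a
  -- path.
  have heq : I \ J = (Finset.range (m - k)).image fun i => p (k + i) := by
    ext s
    simp only [Finset.mem_sdiff, Finset.mem_image, Finset.mem_range]
    constructor
    · rintro ⟨hs, hsJ⟩
      obtain ⟨i, hi, rfl⟩ := h.surj s hs
      have : k ≤ i := Nat.find_min' hex ⟨hi, hsJ⟩
      exact ⟨i - k, by omega, congrArg p (by omega)⟩
    · rintro ⟨i, hi, rfl⟩
      exact ⟨h.mem _ (by omega), fun hJ' => hkJ (down _ (by omega) hJ' _ (by omega))⟩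
  apply hdis
  rw [heq]
  exact preconnected_of_mem_paths
    ((h.segment (a := k) (k := m - k) (by omega)).mem_paths (by omega))

end IsPathOrder

end PathOrder

/-! ### The member of a family that splits an edge -/

section Special

variable {S : Type*} [DecidableEq S] {G : SimpleGraph S} {B : Finset (Finset S)} {s t : S}

/-- Adjacent vertices occupy consecutive positions, one of which is odd. -/
theorem exists_evPart_of_adj {I : Finset S} (hI : I ∈ oddPaths G) (hst : G.Adj s t)
    (hs : s ∈ I) (ht : t ∈ I) : s ∈ evPart G I ∨ t ∈ evPart G I := by
  obtain ⟨p, m, h⟩ := exists_isPathOrder hI.1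
  have hodd : Odd m := h.card_eq ▸ hI.2
  obtain ⟨i, hi, rfl⟩ := h.surj s hs
  obtain ⟨j, hj, rfl⟩ := h.surj t ht
  rw [h.adj i hi j hj] at hst
  rcases Nat.even_or_odd i with he | ho
  · refine Or.inr (h.mem_evPart hodd hj ?_)
    obtain ⟨c, rfl⟩ := he
    rcases hst with rfl | hst
    · exact ⟨c, by omega⟩
    · exact ⟨c - 1, by omega⟩
  · exact Or.inl (h.mem_evPart hodd hi ho)

/-- The member of `B` that separates the two ends of the edge `s t`. -/
theorem exists_splitting (hB : B ∈ phi G) (hst : G.Adj s t)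
    (h : ∃ I ∈ B, s ∈ I ∨ t ∈ I) :
    ∃ I ∈ B, (s ∈ I ∧ t ∉ I) ∨ (t ∈ I ∧ s ∉ I) := by
  obtain ⟨I, hI, hmin⟩ := Finset.exists_min_image (B.filter fun I => s ∈ I ∨ t ∈ I)
    Finset.card (by obtain ⟨I, hI⟩ := h; exact ⟨I, by simpa using hI⟩)
  simp only [Finset.mem_filter, and_imp] at hI hmin
  refine ⟨I, hI.1, ?_⟩
  by_contra hcon
  have hsI : s ∈ I := by tauto
  have htI : t ∈ I := by tauto
  obtain ⟨C, hCB, -, hC, hev⟩ := hB.2.2 I hI.1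
  obtain ⟨u, hu, hue⟩ : ∃ u, (u = s ∨ u = t) ∧ u ∈ evPart G I := by
    rcases exists_evPart_of_adj (hB.1 I hI.1) hst hsI htI with hu | hu
    exacts [⟨s, Or.inl rfl, hu⟩, ⟨t, Or.inr rfl, hu⟩]
  obtain ⟨J, hJ, huJ⟩ := Finset.mem_biUnion.1 (Finset.mem_coe.1 (hev hue))
  have hlt := Finset.card_lt_card (hC J hJ).1
  have := hmin J (hCB hJ) (by rcases hu with rfl | rfl; exacts [Or.inl huJ, Or.inr huJ])
  omega

theorem not_separated_of_adj {I J : Finset S} (hI : I ∈ paths G) (hJ : J ∈ paths G)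
    (hst : G.Adj s t) (hs : s ∈ I) (ht : t ∈ J) : ¬ Separated G I J := by
  rintro ⟨-, hdis⟩
  apply hdis
  rw [Finset.coe_union]
  exact (SimpleGraph.connected_induce_union (preconnected_of_mem_paths hI)
    (preconnected_of_mem_paths hJ) hs ht hst).preconnected

/-- Since s has a neighbour t outside I and degree at most 2, it is an end of the path I; a
connected J containing an end has connected complement in I. -/
theorem not_nested_of_adj {I J : Finset S} (hI : I ∈ paths G) (hJ : J ∈ paths G)
    (hdeg : ∀ a b c, G.Adj s a → G.Adj s b → G.Adj s c → a = b ∨ a = c ∨ b = c)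
    (hst : G.Adj s t) (hs : s ∈ J) (ht : t ∉ I) : ¬ Nested G J I := by
  intro hN
  obtain ⟨p, m, h⟩ := exists_isPathOrder hI
  obtain ⟨i, hi, rfl⟩ := h.surj s (hN.1.1 hs)
  have hJ' := preconnected_of_mem_paths hJ
  rcases Nat.eq_zero_or_pos i with rfl | h0
  · exact h.not_nested hJ' hs hN
  by_cases hl : i + 1 < m
  · rcases hdeg t (p (i - 1)) (p (i + 1)) hst ((h.adj _ hi _ (by omega)).2 (by omega))
      ((h.adj _ hi _ (by omega)).2 (by omega)) with e | e | e
    · exact ht (e ▸ h.mem _ (by omega))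
    · exact ht (e ▸ h.mem _ hl)
    · have := h.inj _ (by omega) _ hl e
      omega
  -- Here s is the last vertex, so the path is read backwards.
  · refine h.reverse.not_nested hJ' ?_ hN
    have : m - 1 - 0 = i := by omega
    simpa [this] using hs

/-- Two members splitting the edge on the same side share an end and could only be nested, which
`not_nested_of_adj` excludes. On opposite sides they are joined by the edge, so not separated, and
neither contains the other. -/
theorem splitting_unique (hB : B ∈ phi G)
    (hdeg : ∀ s a b c, G.Adj s a → G.Adj s b → G.Adj s c → a = b ∨ a = c ∨ b = c)
    (hst : G.Adj s t) {I J : Finset S} (hI : I ∈ B) (hJ : J ∈ B) (hsI : s ∈ I) (htI : t ∉ I)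
    (hJst : (s ∈ J ∧ t ∉ J) ∨ (t ∈ J ∧ s ∉ J)) : J = I := by
  have pI := (hB.1 I hI).1
  have pJ := (hB.1 J hJ).1
  rcases hJst with ⟨hs, ht⟩ | ⟨ht, hs⟩
  · rcases hB.2.1 J hJ I hI with h | h | h | h
    · exact h
    · exact absurd hsI (Finset.disjoint_left.1 h.1 hs)
    · exact absurd h (not_nested_of_adj pI pJ (hdeg s) hst hs htI)
    · exact absurd h (not_nested_of_adj pJ pI (hdeg s) hst hsI ht)
  · rcases hB.2.1 J hJ I hI with h | h | h | h
    · exact h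
    · exact absurd h (not_separated_of_adj pJ pI hst.symm ht hsI)
    · exact absurd (h.1.1 ht) htI
    · exact absurd (h.1.1 hsI) hs

theorem card_inter_pair (hne : s ≠ t) (I : Finset S) :
    (I ∩ {s, t}).card = (if s ∈ I then 1 else 0) + (if t ∈ I then 1 else 0) := by
  by_cases hs : s ∈ I <;> by_cases ht : t ∈ I <;>
    simp [Finset.inter_insert_of_mem, Finset.inter_insert_of_notMem, Finset.card_pair hne, hs, ht]

theorem card_inter_pair_eq_one (hne : s ≠ t) (I : Finset S) :
    (I ∩ {s, t}).card = 1 ↔ (s ∈ I ∧ t ∉ I) ∨ (t ∈ I ∧ s ∉ I) := by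
  rw [card_inter_pair hne]
  by_cases hs : s ∈ I <;> by_cases ht : t ∈ I <;> simp [hs, ht]

/-- If a member of `B` meets the edge `s t`, exactly one member contains exactly one end of it. -/
theorem existsUnique_special (hB : B ∈ phi G)
    (hdeg : ∀ s a b c, G.Adj s a → G.Adj s b → G.Adj s c → a = b ∨ a = c ∨ b = c)
    (hst : G.Adj s t) (h : ∃ I ∈ B, s ∈ I ∨ t ∈ I) :
    ∃! I, I ∈ B ∧ (I ∩ {s, t}).card = 1 := by
  obtain ⟨I, hI, hIst⟩ := exists_splitting hB hst h
  refine ⟨I, ⟨hI, (card_inter_pair_eq_one hst.ne I).2 hIst⟩, ?_⟩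
  rintro J ⟨hJ, hJst⟩
  rw [card_inter_pair_eq_one hst.ne] at hJst
  rcases hIst with ⟨hs, ht⟩ | ⟨ht, hs⟩
  · exact splitting_unique hB hdeg hst hI hJ hs ht hJst
  · exact splitting_unique hB hdeg hst.symm hI hJ ht hs hJst.symm

theorem mult_eq_of_unique {I : Finset S} (hI : I ∈ B) (hs : s ∈ I) (ht : t ∉ I)
    (hu : ∀ J ∈ B, (J ∩ {s, t}).card = 1 → J = I) (hne : s ≠ t) :
    mult B s = edgeMult {s, t} B + 1 ∧ mult B t = edgeMult {s, t} B := by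
  have huniq : ∀ J ∈ B, J ≠ I → (s ∈ J ↔ t ∈ J) := by
    intro J hJ hJI
    have := mt (hu J hJ) hJI
    rw [card_inter_pair_eq_one hne] at this
    tauto
  constructor
  · have : (B.filter fun J => s ∈ J) = insert I (B.filter fun J => {s, t} ⊆ J) := by
      ext J
      simp only [Finset.mem_filter, Finset.mem_insert, Finset.insert_subset_iff,
        Finset.singleton_subset_iff]
      by_cases h : J = I
      · subst h
        tauto
      · have := huniq J
        tauto
    rw [mult, this, Finset.card_insert_of_notMem, edgeMult]
    simp [Finset.insert_subset_iff, ht]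
  · rw [mult, edgeMult]
    congr 1
    ext J
    simp only [Finset.mem_filter, Finset.insert_subset_iff, Finset.singleton_subset_iff]
    by_cases h : J = I
    · subst h
      tauto
    · have := huniq J
      tauto

/-- T(n + 1) = T(n) + (n + 1), and the two copies of T(n) cancel mod 2. -/
theorem triangle_add_succ (n : ℕ) :
    ((n * (n + 1) / 2 : ℕ) : ZMod 2) + (((n + 1) * (n + 1 + 1) / 2 : ℕ) : ZMod 2) =
      ((n + 1 : ℕ) : ZMod 2) := by
  have : (n + 1) * (n + 1 + 1) / 2 = n * (n + 1) / 2 + (n + 1) := by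
    rw [← Nat.add_mul_div_right _ _ (by norm_num : 0 < 2)]
    congr 1
    ring
  rw [this, Nat.cast_add, ← add_assoc, CharTwo.add_self_eq_zero, zero_add]

theorem triangle_add_mult (hB : B ∈ phi G)
    (hdeg : ∀ s a b c, G.Adj s a → G.Adj s b → G.Adj s c → a = b ∨ a = c ∨ b = c)
    (hst : G.Adj s t) (h : ∃ I ∈ B, s ∈ I ∨ t ∈ I) :
    ((mult B s * (mult B s + 1) / 2 : ℕ) : ZMod 2) + ((mult B t * (mult B t + 1) / 2 : ℕ) : ZMod 2) =
      ((edgeMult {s, t} B + 1 : ℕ) : ZMod 2) := by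
  obtain ⟨I, ⟨hI, hI1⟩, hu⟩ := existsUnique_special hB hdeg hst h
  rcases (card_inter_pair_eq_one hst.ne I).1 hI1 with ⟨hs, ht⟩ | ⟨ht, hs⟩
  · obtain ⟨h1, h2⟩ := mult_eq_of_unique hI hs ht (fun J hJ hJ1 => hu J ⟨hJ, hJ1⟩) hst.ne
    rw [h1, h2, add_comm, triangle_add_succ]
  · obtain ⟨h1, h2⟩ := mult_eq_of_unique hI ht hs
      (fun J hJ hJ1 => hu J ⟨hJ, by rwa [Finset.pair_comm]⟩) hst.ne'
    rw [h1, h2, triangle_add_succ, Finset.pair_comm]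

theorem forall_bang_iff (hB : B ∈ phi G)
    (hdeg : ∀ s a b c, G.Adj s a → G.Adj s b → G.Adj s c → a = b ∨ a = c ∨ b = c)
    (hst : G.Adj s t) (h : ∃ I ∈ B, s ∈ I ∨ t ∈ I) :
    (∀ I ∈ bang {s, t} B, (I ∩ {s, t}).card = 0 ∨ (I ∩ {s, t}).card = 2) ↔
      Odd (edgeMult {s, t} B) := by
  obtain ⟨I, ⟨hI, hI1⟩, hu⟩ := existsUnique_special hB hdeg hst h
  by_cases hodd : Odd (edgeMult {s, t} B)
  -- Uniqueness identifies the arbitrary choice in `special` with I.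
  · have hsp : special {s, t} B = I := hu _ (Classical.epsilon_spec
      (p := fun I => I ∈ B ∧ (I ∩ {s, t}).card = 1) ⟨I, hI, hI1⟩)
    simp only [bang, hsp, hodd, if_true, iff_true, Finset.mem_erase]
    rintro J ⟨hJI, hJ⟩
    have h1 : (J ∩ {s, t}).card ≠ 1 := fun e => hJI (hu J ⟨hJ, e⟩)
    have h2 : (J ∩ {s, t}).card ≤ 2 :=
      (Finset.card_le_card Finset.inter_subset_right).trans Finset.card_le_two
    omega
  · simp only [bang, hodd, if_false, iff_false]
    intro hall
    have := hall I hI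
    omega

end Special

/-! ### The function z on ε and on the subspaces ⟨B⟩ -/

namespace AffineData

variable {S V : Type*} [Fintype S] [AddCommGroup V] [Module (ZMod 2) V] (D : AffineData S V)

theorem graph_eq : D.graph = edgeGraph D.form D.e := rfl

theorem eq_of_adj_three (s a b c : S) (ha : D.graph.Adj s a) (hb : D.graph.Adj s b)
    (hc : D.graph.Adj s c) : a = b ∨ a = c ∨ b = c := by
  classical
  have hdeg : D.graph.degree s = 2 := by
    obtain ⟨f⟩ := D.cycle
    rw [← graph_eq] at f
    rw [← f.degree_eq s]
    generalize f s = u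
    revert u
    obtain ⟨k, hk⟩ := Nat.exists_eq_add_of_le D.three_le
    rw [hk, Nat.add_comm 3 k]
    intro u
    convert SimpleGraph.cycleGraph_degree_three_le (v := u)
  by_contra! hne
  have : ({a, b, c} : Finset S) ⊆ D.graph.neighborFinset s := by
    simp [Finset.insert_subset_iff, ha, hb, hc]
  have hle := Finset.card_le_card this
  rw [D.graph.card_neighborFinset_eq_degree, hdeg,
    Finset.card_eq_three.2 ⟨a, b, c, hne.1, hne.2.1, hne.2.2, rfl⟩] at hle
  omega

variable [DecidableEq S]

theorem z_eps {s t : S} (hee : D.IsEdge {s, t}) (hne : s ≠ t) (B : Finset (Finset S)) :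
    D.z {s, t} hee (eps D.ebar B) = ((mult B s * (mult B s + 1) / 2 : ℕ) : ZMod 2) +
      ((mult B t * (mult B t + 1) / 2 : ℕ) : ZMod 2) := by
  simp only [eps, map_sum, map_smul, z_ebar, smul_eq_mul, mul_ite, mul_one, mul_zero]
  rw [← Finset.sum_filter, Finset.filter_mem_eq_inter, Finset.univ_inter, Finset.sum_pair hne]

theorem z_eps_eq_zero_iff {s t : S} (hst : D.graph.Adj s t) (hee : D.IsEdge {s, t})
    {B : Finset (Finset S)} (hB : B ∈ phi D.graph) :
    D.z {s, t} hee (eps D.ebar B) = 0 ↔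
      ∀ I ∈ bang {s, t} B, (I ∩ {s, t}).card = 0 ∨ (I ∩ {s, t}).card = 2 := by
  rw [z_eps D hee hst.ne]
  by_cases h : ∃ I ∈ B, s ∈ I ∨ t ∈ I
  · rw [triangle_add_mult hB D.eq_of_adj_three hst h,
      forall_bang_iff hB D.eq_of_adj_three hst h, ZMod.natCast_eq_zero_iff_even,
      Nat.even_add_one, Nat.not_even_iff_odd]
  · push Not at h
    have h1 : mult B s = 0 := by
      simpa [mult, Finset.filter_eq_empty_iff] using fun I hI => (h I hI).1
    have h2 : mult B t = 0 := by
      simpa [mult, Finset.filter_eq_empty_iff] using fun I hI => (h I hI).2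
    simp only [h1, h2, zero_mul, Nat.zero_div, Nat.cast_zero, add_zero, true_iff]
    intro I hI
    have hIB : I ∈ B := by
      rw [bang] at hI
      split_ifs at hI
      exacts [Finset.mem_of_mem_erase hI, hI]
    left
    simp [h I hIB]

theorem mem_omegaPlus_iff {ee : Finset S} (hee : D.IsEdge ee) {B : Finset (Finset S)}
    (hB : B ∈ D.omegaBar ee) :
    B ∈ D.omegaPlus ee hee ↔ ∀ I ∈ B, (I ∩ ee).card = 0 ∨ (I ∩ ee).card = 2 := by
  obtain ⟨s, t, hst, rfl⟩ := id hee
  have hmem : tilde D.graph {s, t} B ∈ phi D.graph := Function.invFunOn_mem hB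
  have heq : bang {s, t} (tilde D.graph {s, t} B) = B := Function.invFunOn_eq hB
  have := D.z_eps_eq_zero_iff hst hee hmem
  rw [heq] at this
  rw [← this]
  exact ⟨fun h => h.2, fun h => ⟨hB, h⟩⟩

theorem spanOf_le_ker_z {ee : Finset S} (hee : D.IsEdge ee) {B : Finset (Finset S)}
    (hB : ∀ I ∈ B, (I ∩ ee).card = 0 ∨ (I ∩ ee).card = 2) :
    D.spanOf B ≤ LinearMap.ker (D.z ee hee) := by
  rw [spanOf, Submodule.span_le]
  rintro _ ⟨I, hI, rfl⟩
  simp only [SetLike.mem_coe, LinearMap.mem_ker, map_sum, z_ebar, Finset.sum_boole,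
    Finset.filter_mem_eq_inter]
  rcases hB I hI with h | h
  · simp [h]
  · rw [h]
    decide

end AffineData

end IsotropicFamily

theorem mainTheorem8 {S V : Type*} [Fintype S] [DecidableEq S] [AddCommGroup V]
    [Module (ZMod 2) V] (D : IsotropicFamily.AffineData S V)
    (ee : Finset S) (hee : D.IsEdge ee) :
    (∀ B ∈ D.omegaBar ee,
      (B ∈ D.omegaPlus ee hee ↔ ∀ I ∈ B, (I ∩ ee).card = 0 ∨ (I ∩ ee).card = 2)) ∧
    (∀ B' B : D.omegaBar ee, D.Preceq ee B' B →
      B.1 ∈ D.omegaPlus ee hee → B'.1 ∈ D.omegaPlus ee hee) := by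
  refine ⟨fun B hB => D.mem_omegaPlus_iff hee hB, fun B' B h hB => ?_⟩
  -- The chain is traversed from its top B down to B'; each step needs only part (1) for the larger
  -- term.
  induction h using Relation.ReflTransGen.head_induction_on with
  | refl => exact hB
  | head hstep _ ih =>
    exact ⟨Subtype.coe_prop _, D.spanOf_le_ker_z hee
      ((D.mem_omegaPlus_iff hee (Subtype.coe_prop _)).1 ih) hstep⟩
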